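/- For a finite subset $S$ of an abelian group $G$, a coloring of the elements of $G$ is called $S$-polychromatic if every translate $n+S=\{n+s : s\in S\}$, $n \in G$, contains an element of each color. The polychromatic number $p_G(S)$ is the largest number of colors in an $S$-polychromatic coloring of $G$. A finite set of points of $\mathbb{Z}^d$ is in general position if any at most $d+1$ of its points are affinely independent (so for $d=2$ no three of the points are collinear, and for $d\ge 3$ four points are in general position if and only if they do not lie in a common plane). Theorem. Let $d \ge 2$ and let $S \subseteq \mathbb{Z}^d$ be a set of cardinality $4$ with $0 \in S$. Then: 1. If all points of $S$ are collinear, then $p_{\mathbb{Z}^d}(S)$ is $3$ or $4$. 2. If exactly three points of $S$ are collinear, then $p_{\mathbb{Z}^d}(S) = 4$. 3. If $d \ge 3$ and the four points of $S$ are in general position, then $p_{\mathbb{Z}^d}(S) = 4$. 4. If $d = 2$ and the four points of $S$ are in general position, then $p_{\mathbb{Z}^2}(S)$ is $3$ or $4$. -/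

import Mathlib

/-- A coloring `χ` of an additive abelian group `G` is `S`-polychromatic if every translate `n + S`
contains an element of each color. -/
def IsPolychromatic {G C : Type*} [AddCommGroup G] (S : Finset G) (χ : G → C) : Prop :=
  ∀ (n : G) (c : C), ∃ s ∈ S, χ (n + s) = c

/-- The polychromatic number `p_G(S)` of a finite set `S`: the largest number of colors in an
`S`-polychromatic coloring of `G`. -/
noncomputable def polychromaticNumber {G : Type*} [AddCommGroup G] (S : Finset G) : ℕ :=
  sSup {k : ℕ | ∃ χ : G → Fin k, IsPolychromatic S χ}

/-- For a nonempty finite set the supremum defining the polychromatic number is a maximum. -/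
theorem isGreatest_polychromaticNumber {G : Type*} [AddCommGroup G] (S : Finset G)
    (hS : S.Nonempty) :
    IsGreatest {k : ℕ | ∃ χ : G → Fin k, IsPolychromatic S χ} (polychromaticNumber S) := by
  have hb : BddAbove {k : ℕ | ∃ χ : G → Fin k, IsPolychromatic S χ} := by
    refine ⟨S.card, ?_⟩
    rintro k ⟨χ, hχ⟩
    have h : (Finset.univ : Finset (Fin k)) ⊆ S.image (fun s => χ (0 + s)) := by
      intro c _
      obtain ⟨s, hs, h⟩ := hχ 0 c
      exact Finset.mem_image.2 ⟨s, hs, h⟩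
    simpa using (Finset.card_le_card h).trans Finset.card_image_le
  have hne : {k : ℕ | ∃ χ : G → Fin k, IsPolychromatic S χ}.Nonempty := by
    obtain ⟨s, hs⟩ := hS
    exact ⟨1, fun _ => 0, fun _ _ => ⟨s, hs, Subsingleton.elim _ _⟩⟩
  exact ⟨Nat.sSup_mem hne hb, fun _ hk => le_csSup hb hk⟩

/-- A lattice point of `ℤ^d` viewed as a point of the affine space `ℚ^d`. -/
def toRatPoint {d : ℕ} (v : Fin d → ℤ) : Fin d → ℚ := fun i => (v i : ℚ)

/-- The points of `S` lie on a common line. -/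
def LatticeCollinear {d : ℕ} (S : Finset (Fin d → ℤ)) : Prop :=
  Collinear ℚ (toRatPoint '' (S : Set (Fin d → ℤ)))

/-- Exactly three points of `S` are collinear: three points of `S` lie on a common line, and no four
of them do. -/
def ExactlyThreeCollinear {d : ℕ} (S : Finset (Fin d → ℤ)) : Prop :=
  (∃ T ⊆ S, T.card = 3 ∧ LatticeCollinear T) ∧ ¬ ∃ T ⊆ S, T.card = 4 ∧ LatticeCollinear T

/-- The points of `S` are in general position in `d`-dimensional space: any at most `d + 1` of them
are affinely independent, i.e. for every `k < d` no `k + 2` of them lie on a common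
`k`-dimensional flat. -/
def InGeneralPosition {d : ℕ} (S : Finset (Fin d → ℤ)) : Prop :=
  ∀ T ⊆ S, T.card ≤ d + 1 → AffineIndependent ℚ (fun t : T => toRatPoint (t : Fin d → ℤ))

/-! No colouring uses more than `S.card = 4` colours, so everything is a matter of constructing
colourings. A colouring of `ℤ` pulls back along a rational linear functional, so each case reduces
to a suitable image of `S` in `ℤ`.

Four colours: if `S` is affinely independent, a functional sends it to four consecutive integers,
which are coloured mod 4. If exactly three points are collinear, they map to `0, a, b` with `a, b`
coprime, and the value `c` at the fourth point is free; it is chosen so that one parity bit and one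
higher binary digit separate `0, a, b, c` in every translate.

Three colours always suffice (`exists_isPolychromatic_int`). A functional injective on `S` reduces
to `{0, a, b, c}` with `0 < a < b < c` and gcd 1. Wrap `ℤ` around a circle of length `N` by `m ↦ k
m` and cut the circle into three equal arcs; this works when the images of the four points leave no
gap longer than `N / 3`. With `N = n = c + b - a` one has `a ≡ b + c`, so the images are `0, X, Y, X
+ Y` with `(X, Y) = k (b, c)`, and the gap condition puts `(X, Y)` in a fixed region of the torus.
The multiples of `(b, c)` mod `n` form a planar lattice with a basis of determinant `n`. Reducing
the basis gives a short vector, and for `n ≥ 66` some lattice row parallel to it has a point in the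
region, unless that vector is one of a few tiny ones. Those force `3b = a + c` or `3a = b + c`,
where an explicit colouring mod `n` is used instead. The case `n < 66` is a finite search. -/

/-! ### Transporting colourings, and arc colourings of a circle -/

/-- Adding `D * t` before the floor division by `D` adds exactly `t` after it, whatever the residue
of `φ n`; so translations and common factors in the image of `S` are harmless. -/
theorem IsPolychromatic.of_map {G C : Type*} [AddCommGroup G] {S : Finset G} {T : Finset ℤ}
    {f : ℤ → C} (hf : IsPolychromatic T f) (φ : G →+ ℤ) {D e : ℤ} (hD : D ≠ 0)
    (h : ∀ t ∈ T, ∃ s ∈ S, φ s = D * t + e) :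
    IsPolychromatic S (fun x => f ((φ x - e) / D)) := by
  intro n c
  obtain ⟨t, ht, hc⟩ := hf (φ n / D) c
  obtain ⟨s, hs, hφ⟩ := h t ht
  refine ⟨s, hs, ?_⟩
  have : (φ (n + s) - e) / D = φ n / D + t := by
    rw [map_add, hφ, show φ n + (D * t + e) - e = φ n + D * t by ring,
      Int.add_mul_ediv_left _ _ hD]
  simpa only [this] using hc

/-- Cutting the circle into three arcs: `m ↦ ⌊3 (k m mod N) / N⌋` is polychromatic as soon as from
every point of `S` the next one on the circle is at distance at most a third. -/
theorem exists_isPolychromatic_of_circle {S : Finset ℤ} (hS : S.Nonempty) {N k : ℤ} (hN : 0 < N)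
    (h : ∀ s ∈ S, ∃ s' ∈ S, ∃ δ, N ∣ k * (s' - s) - δ ∧ 0 < δ ∧ 3 * δ ≤ N) :
    ∃ χ : ℤ → Fin 3, IsPolychromatic S χ := by
  have hlt : ∀ m : ℤ, (3 * (k * m % N) / N).toNat < 3 := by
    intro m
    have h1 := Int.emod_nonneg (k * m) hN.ne'
    have h2 := Int.emod_lt_of_pos (k * m) hN
    have : 3 * (k * m % N) / N < 3 := by
      rw [Int.ediv_lt_iff_lt_mul hN]; linarith
    omega
  refine ⟨fun m => ⟨(3 * (k * m % N) / N).toNat, hlt m⟩, ?_⟩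
  intro z c
  -- Arc `c` starts at `c * N / 3`; everything is scaled by 3 to stay integral. Take the point
  -- farthest around the circle from that start, i.e. the last one before returning to it. A step
  -- `δ` from it must cross the start, by maximality, and since `3 * δ ≤ N` it lands inside the arc.
  obtain ⟨s, hs, hmax⟩ := S.exists_max_image
    (fun s => (3 * (k * (z + s)) - (c : ℕ) * N) % (3 * N)) hS
  obtain ⟨s', hs', δ, ⟨j, hj⟩, hδ0, hδ⟩ := h s hs
  refine ⟨s', hs', ?_⟩
  have hle := hmax s' hs'
  have hN3 : 0 < 3 * N := by linarith
  set g := (3 * (k * (z + s)) - (c : ℕ) * N) % (3 * N) with hg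
  have hg0 : 0 ≤ g := Int.emod_nonneg _ hN3.ne'
  have hg1 : g < 3 * N := Int.emod_lt_of_pos _ hN3
  have hgd := Int.mul_ediv_add_emod (3 * (k * (z + s)) - (c : ℕ) * N) (3 * N)
  rw [← hg] at hgd
  set i := (3 * (k * (z + s)) - (c : ℕ) * N) / (3 * N)
  have hs'eq : 3 * (k * (z + s')) - (c : ℕ) * N = (g + 3 * δ) + 3 * N * (i + j) := by
    linear_combination 3 * hj - hgd
  have hge : 3 * N ≤ g + 3 * δ := by
    by_contra hlt'
    push Not at hlt'
    rw [hs'eq, Int.add_mul_emod_self_left, Int.emod_eq_of_lt (by linarith) hlt'] at hle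
    linarith
  have hc3 : ((c : ℕ) : ℤ) ≤ 2 := by have := c.2; omega
  have hc0 : (0 : ℤ) ≤ ((c : ℕ) : ℤ) := by positivity
  obtain ⟨e, he⟩ : ∃ e, k * (z + s') = e + N * (i + j + 1) := ⟨_, (sub_add_cancel _ _).symm⟩
  have he3 : 3 * e = (g + 3 * δ - 3 * N) + (c : ℕ) * N := by
    linear_combination hs'eq - 3 * he
  have he0 : 0 ≤ e := by nlinarith
  have heN : e < N := by nlinarith
  have hmod : k * (z + s') % N = e := by
    rw [he, Int.add_mul_emod_self_left, Int.emod_eq_of_lt he0 heN]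
  have hdiv : 3 * e / N = (c : ℕ) := by
    rw [he3, Int.add_mul_ediv_right _ _ hN.ne', Int.ediv_eq_zero_of_lt (by linarith) (by linarith),
      zero_add]
  ext
  simp only [hmod, hdiv, Int.toNat_natCast]

theorem IsPolychromatic.neg {C : Type*} {S T : Finset ℤ} {f : ℤ → C} (hf : IsPolychromatic T f)
    (e : ℤ) (h : ∀ t ∈ T, e - t ∈ S) : IsPolychromatic S (fun x => f (-x)) := by
  intro n c
  obtain ⟨t, ht, hc⟩ := hf (-n - e) c
  exact ⟨e - t, h t ht, (congrArg f (by ring)).trans hc⟩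

/-! ### The finite search for `c + b - a < 66` -/

/-- On the circle of length `N`, going from `u` to `v` takes a positive distance of at most a third. -/
def isShortStep (N u v : ℕ) : Bool :=
  (Nat.ble (.succ u) v && Nat.ble (.mul 3 (.sub v u)) N) ||
    Nat.ble (.mul 3 (.add N v)) (.add N (.mul 3 u))

/-- The next one of the points `0, a, b, c` on the circle of length `N`, after stretching by `k`,
is always at distance at most a third. -/
def smallGaps (a b c N k : ℕ) : Bool :=
  let p := Nat.mod (Nat.mul k a) N
  let q := Nat.mod (Nat.mul k b) N
  let r := Nat.mod (Nat.mul k c) N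
  (isShortStep N 0 p || isShortStep N 0 q || isShortStep N 0 r) &&
  (isShortStep N p 0 || isShortStep N p q || isShortStep N p r) &&
  (isShortStep N q 0 || isShortStep N q p || isShortStep N q r) &&
  (isShortStep N r 0 || isShortStep N r p || isShortStep N r q)

/-- Some stretching factor `1 ≤ k ≤ K` gives small gaps on the circle of length `N`. -/
def searchGaps (a b c N K : ℕ) : Bool :=
  Nat.rec false (fun k found => smallGaps a b c N (.succ k) || found) K

/-- A search for a good stretching factor on circles of a few lengths, for coprime `a, b, c` none of which
is the centroid of the other points, and `(a, b, c) ≠ (1, 7, 9)`. -/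
def checkTriple (a b c : ℕ) : Bool :=
  Nat.blt 1 (Nat.gcd a (Nat.gcd b c)) || Nat.beq (.mul 3 b) (.add a c) ||
  Nat.beq (.mul 3 a) (.add b c) || searchGaps a b c (c + b - a) ((c + b - a) / 2) ||
  searchGaps a b c (3 * c) (3 * c / 2) || searchGaps a b c (3 * b) (3 * b / 2) ||
  searchGaps a b c (3 * (c - a)) (3 * (c - a) / 2) ||
  searchGaps a b c (3 * (c - b)) (3 * (c - b) / 2) || (Nat.beq a 1 && Nat.beq b 7 && Nat.beq c 9)

/-- Check all `0 < a < b < c` with `a + b ≤ c` and `c + (b - a) < n`. -/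
def checkBelow (n : ℕ) : Bool :=
  (List.range n).all fun c => (List.range (n - c)).all fun d =>
    (List.range ((c - d) / 2)).all fun a =>
      Nat.beq d 0 || checkTriple (a + 1) (a + 1 + d) c

set_option maxRecDepth 100000 in
theorem checkBelow_66 : checkBelow 66 = true := by
  decide +kernel

theorem exists_isPolychromatic_of_smallGaps {a b c N k : ℕ} (hN : 0 < N)
    (h : smallGaps a b c N k = true) :
    ∃ χ : ℤ → Fin 3, IsPolychromatic ({0, (a : ℤ), (b : ℤ), (c : ℤ)} : Finset ℤ) χ := by
  have key : ∀ s t : ℕ, isShortStep N (k * s % N) (k * t % N) = true →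
      ∃ δ : ℤ, (N : ℤ) ∣ (k : ℤ) * ((t : ℤ) - (s : ℤ)) - δ ∧ 0 < δ ∧ 3 * δ ≤ N := by
    intro s t hst
    have h1 : (N : ℤ) ∣ k * t - (k * t % N : ℕ) := by
      rw [Int.natCast_emod]; push_cast; exact Int.dvd_self_sub_emod
    have h2 : (N : ℤ) ∣ k * s - (k * s % N : ℕ) := by
      rw [Int.natCast_emod]; push_cast; exact Int.dvd_self_sub_emod
    have h3 := Nat.mod_lt (k * s) hN
    obtain ⟨i, hi⟩ := h1
    obtain ⟨j, hj⟩ := h2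
    have hst : (k * s % N < k * t % N ∧ 3 * (k * t % N - k * s % N) ≤ N) ∨
        3 * (N + k * t % N) ≤ N + 3 * (k * s % N) := by
      simpa [isShortStep, Nat.ble_eq] using hst
    rcases hst with ⟨h4, h5⟩ | h4
    · exact ⟨(k * t % N : ℕ) - (k * s % N : ℕ), ⟨i - j, by linear_combination hi - hj⟩, by omega,
        by omega⟩
    · exact ⟨N + (k * t % N : ℕ) - (k * s % N : ℕ), ⟨i - j - 1, by linear_combination hi - hj⟩,
        by omega, by omega⟩
  have h' : ∀ u ∈ [0, a, b, c], ∃ v ∈ [0, a, b, c],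
      isShortStep N (k * u % N) (k * v % N) = true := by
    simp only [smallGaps, Bool.and_eq_true, Bool.or_eq_true] at h
    obtain ⟨⟨⟨h0, h1⟩, h2⟩, h3⟩ := h
    intro u hu
    simp only [List.mem_cons, List.not_mem_nil, or_false] at hu
    rcases hu with rfl | rfl | rfl | rfl
    · rcases h0 with (h | h) | h
      exacts [⟨a, by simp, h⟩, ⟨b, by simp, h⟩, ⟨c, by simp, h⟩]
    · rcases h1 with (h | h) | h
      exacts [⟨0, by simp, h⟩, ⟨b, by simp, h⟩, ⟨c, by simp, h⟩]
    · rcases h2 with (h | h) | h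
      exacts [⟨0, by simp, h⟩, ⟨a, by simp, h⟩, ⟨c, by simp, h⟩]
    · rcases h3 with (h | h) | h
      exacts [⟨0, by simp, h⟩, ⟨a, by simp, h⟩, ⟨b, by simp, h⟩]
  refine exists_isPolychromatic_of_circle (S := {0, (a : ℤ), (b : ℤ), (c : ℤ)})
    (N := N) (k := k) (by simp) (by exact_mod_cast hN) fun s hs => ?_
  have cast_mem : ∀ t : ℤ, t ∈ ({0, (a : ℤ), (b : ℤ), (c : ℤ)} : Finset ℤ) ↔
      ∃ u ∈ [0, a, b, c], t = ((u : ℕ) : ℤ) := by simp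
  obtain ⟨u, hu, rfl⟩ := (cast_mem s).1 hs
  obtain ⟨v, hv, huv⟩ := h' u hu
  exact ⟨v, (cast_mem _).2 ⟨v, hv, rfl⟩, key u v huv⟩

theorem exists_isPolychromatic_of_searchGaps {a b c N : ℕ} (hN : 0 < N) (K : ℕ)
    (h : searchGaps a b c N K = true) :
    ∃ χ : ℤ → Fin 3, IsPolychromatic ({0, (a : ℤ), (b : ℤ), (c : ℤ)} : Finset ℤ) χ := by
  induction K with
  | zero => exact absurd h Bool.false_ne_true
  | succ K ih =>
    have h : (smallGaps a b c N (K + 1) || searchGaps a b c N K) = true := h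
    rcases Bool.or_eq_true_iff.1 h with h | h
    · exact exists_isPolychromatic_of_smallGaps hN h
    · exact ih h

/-- Besides `c + b - a`, the search tries circles three times as long as a difference of two of the
points, so that a factor `k` prime to 3 puts those two exactly a third apart. The condition `a + b ≤
c` costs nothing: the reflection `x ↦ c - x` preserves `c + b - a`. -/
theorem exists_isPolychromatic_of_small {a b c : ℕ} (ha : 0 < a) (hab : a < b) (hbc : b < c)
    (hn : c + b - a < 66) (habc : a + b ≤ c) (hg : Nat.gcd a (Nat.gcd b c) = 1)
    (h1 : 3 * b ≠ a + c) (h2 : 3 * a ≠ b + c) :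
    ∃ χ : ℤ → Fin 3, IsPolychromatic ({0, (a : ℤ), (b : ℤ), (c : ℤ)} : Finset ℤ) χ := by
  have h := checkBelow_66
  simp only [checkBelow, List.all_eq_true, List.mem_range] at h
  have h := h c (by omega) (b - a) (by omega) (a - 1) (by omega)
  rw [show a - 1 + 1 = a by omega, show a + (b - a) = b by omega] at h
  have h : (b - a = 0) ∨ (((((((1 < Nat.gcd a (Nat.gcd b c) ∨ Nat.mul 3 b = Nat.add a c) ∨
      Nat.mul 3 a = Nat.add b c) ∨
      searchGaps a b c (c + b - a) ((c + b - a) / 2) = true) ∨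
      searchGaps a b c (3 * c) (3 * c / 2) = true) ∨ searchGaps a b c (3 * b) (3 * b / 2) = true) ∨
      searchGaps a b c (3 * (c - a)) (3 * (c - a) / 2) = true) ∨
      searchGaps a b c (3 * (c - b)) (3 * (c - b) / 2) = true) ∨ (a = 1 ∧ b = 7) ∧ c = 9 := by
    simpa only [checkTriple, Bool.or_eq_true, Bool.and_eq_true, Nat.beq_eq, Nat.blt_eq] using h
  rcases h with h | (((((((h | h) | h) | h) | h) | h) | h) | h) | ⟨⟨h, h'⟩, h''⟩
  · omega
  · omega
  · exact absurd h h1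
  · exact absurd h h2
  all_goals try exact exists_isPolychromatic_of_searchGaps (by omega) _ h
  subst h h' h''
  -- The triple `(1, 7, 9)` left out of the search gets an explicit colouring of period `15 = 9 + 7
  -- - 1`.
  have hcol : ∀ r : Fin 15, ∀ e : Fin 3, ∃ s ∈ ({0, 1, 7, 9} : Finset (Fin 15)),
      (![0, 0, 0, 1, 0, 0, 1, 1, 1, 2, 2, 1, 2, 2, 2] : Fin 15 → Fin 3) (r + s) = e := by
    decide
  refine ⟨fun m => (![0, 0, 0, 1, 0, 0, 1, 1, 1, 2, 2, 1, 2, 2, 2] : Fin 15 → Fin 3) (m : ZMod 15),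
    fun m e => ?_⟩
  obtain ⟨s, hs, he⟩ := hcol ((m : ZMod 15) : Fin 15) e
  simp only [Finset.mem_insert, Finset.mem_singleton] at hs
  have key : ∀ t : ℤ, ((t : ZMod 15) : Fin 15) = s →
      (![0, 0, 0, 1, 0, 0, 1, 1, 1, 2, 2, 1, 2, 2, 2] : Fin 15 → Fin 3) ((m + t : ℤ) : ZMod 15)
        = e := by
    rintro t rfl
    rw [Int.cast_add]; exact he
  rcases hs with rfl | rfl | rfl | rfl
  · exact ⟨0, by simp, key 0 rfl⟩
  · exact ⟨1, by simp, key 1 rfl⟩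
  · exact ⟨7, by simp, key 7 rfl⟩
  · exact ⟨9, by simp, key 9 rfl⟩

/-! ### Lattice points in the good region -/

/-- For a point `(X, Y)` of the torus `(ℤ / n)²`, the four points `0, X, Y, X + Y` cut the circle of
length `n` into arcs of length at most `n / 3`. -/
def InGoodRegion (n X Y : ℤ) : Prop :=
  3 * (|2 * X - n| + |2 * Y - n|) ≤ 2 * n ∧ (n ≤ 3 * |2 * X - n| ∨ n ≤ 3 * |2 * Y - n|)

theorem InGoodRegion.swap {n X Y : ℤ} (h : InGoodRegion n X Y) : InGoodRegion n Y X :=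
  ⟨by rw [add_comm]; exact h.1, h.2.symm⟩

theorem InGoodRegion.reflect {n X Y : ℤ} (h : InGoodRegion n X Y) : InGoodRegion n (n - X) Y := by
  have : |2 * (n - X) - n| = |2 * X - n| := by
    rw [show 2 * (n - X) - n = -(2 * X - n) by ring, abs_neg]
  unfold InGoodRegion
  rwa [this]

/-- In a planar lattice of determinant `n > 0` there is a basis whose first vector has coordinates of
absolute value at most `√n`. -/
theorem exists_short_basis {n : ℤ} (hn : 0 < n) :
    ∀ (N : ℕ) (M : AddSubgroup (ℤ × ℤ)) (p q r s : ℤ), |p| ≤ N → |q| ≤ N → (p, q) ∈ M → (r, s) ∈ M → p * s - q * r = n →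
      ∃ p q r s : ℤ, (p, q) ∈ M ∧ (r, s) ∈ M ∧ p * s - q * r = n ∧ p ^ 2 ≤ n ∧ q ^ 2 ≤ n := by
  intro N
  induction N with
  | zero =>
    intro M p q r s hp hq _ _ h
    have hp0 : p = 0 := abs_eq_zero.1 (le_antisymm (by exact_mod_cast hp) (abs_nonneg p))
    have hq0 : q = 0 := abs_eq_zero.1 (le_antisymm (by exact_mod_cast hq) (abs_nonneg q))
    subst hp0 hq0
    omega
  | succ N ih =>
    have key : ∀ (M : AddSubgroup (ℤ × ℤ)) (p q r s : ℤ), |p| ≤ q → q ≤ (N + 1 : ℕ) → (p, q) ∈ M → (r, s) ∈ M →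
        p * s - q * r = n →
        ∃ p q r s : ℤ, (p, q) ∈ M ∧ (r, s) ∈ M ∧ p * s - q * r = n ∧ p ^ 2 ≤ n ∧ q ^ 2 ≤ n := by
      intro M p q r s hpq hqN hv hw hdet
      by_cases hsmall : q ^ 2 ≤ n
      · exact ⟨p, q, r, s, hv, hw, hdet, (sq_le_sq.2 (hpq.trans (le_abs_self q))).trans hsmall,
          hsmall⟩
      push Not at hsmall
      have hq : 0 < q := by
        rcases (abs_nonneg p |>.trans hpq).eq_or_lt with h | h
        · rw [← h] at hsmall; nlinarith
        · exact h
      obtain ⟨hp1, hp2⟩ := abs_le.1 hpq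
      -- Reduce `s` modulo `q`, rounding in the direction that gives the remainder the sign of `p`.
      -- Then `q * r' = p * s' - n` lies strictly between `-q ^ 2` and `q ^ 2`, because `0 ≤ p * s'
      -- ≤ q * (q - 1)` and `0 < n < q ^ 2`. So `(r', s')` is strictly shorter in the sup norm and
      -- can become the first basis vector.
      obtain ⟨j, hj1, hj2⟩ : ∃ j, |s - j * q| < q ∧ 0 ≤ p * (s - j * q) := by
        rcases le_total 0 p with h | h
        · refine ⟨s / q, ?_⟩
          have e : s - s / q * q = s % q := by rw [Int.emod_def]; ring
          have h1 := Int.emod_nonneg s hq.ne'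
          have h2 := Int.emod_lt_of_pos s hq
          rw [e]
          exact ⟨abs_lt.2 ⟨by linarith, h2⟩, mul_nonneg h h1⟩
        · refine ⟨-(-s / q), ?_⟩
          have e : s - -(-s / q) * q = -(-s % q) := by rw [Int.emod_def]; ring
          have h1 := Int.emod_nonneg (-s) hq.ne'
          have h2 := Int.emod_lt_of_pos (-s) hq
          rw [e]
          exact ⟨abs_lt.2 ⟨by linarith, by linarith⟩, by nlinarith⟩
      have hw' : (r - j * p, s - j * q) ∈ M := by
        have := M.sub_mem hw (M.zsmul_mem hv j)
        simpa using this
      set s' := s - j * q with hs'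
      set r' := r - j * p with hr'
      have hdet' : p * s' - q * r' = n := by rw [hs', hr']; linear_combination hdet
      have hr'q : |r'| < q := by
        obtain ⟨h1, h2⟩ := abs_lt.1 hj1
        have h3 : p * s' ≤ q * (q - 1) := by
          have : p * s' ≤ |p| * |s'| := by rw [← abs_mul]; exact le_abs_self _
          have h4 : |p| * |s'| ≤ q * (q - 1) :=
            mul_le_mul hpq (by omega) (abs_nonneg _) hq.le
          linarith
        rw [abs_lt]
        constructor <;> nlinarith
      refine ih M r' s' (-p) (-q) ?_ ?_ hw' ?_ (by linear_combination hdet')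
      · push_cast at hqN; omega
      · push_cast at hqN; omega
      · simpa using M.neg_mem hv
    have key' : ∀ (M : AddSubgroup (ℤ × ℤ)) (p q r s : ℤ), |p| ≤ |q| → |q| ≤ (N + 1 : ℕ) → (p, q) ∈ M → (r, s) ∈ M →
        p * s - q * r = n →
        ∃ p q r s : ℤ, (p, q) ∈ M ∧ (r, s) ∈ M ∧ p * s - q * r = n ∧ p ^ 2 ≤ n ∧ q ^ 2 ≤ n := by
      intro M p q r s hpq hqN hv hw hdet
      rcases le_total 0 q with h | h
      · rw [abs_of_nonneg h] at hpq hqN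
        exact key M p q r s hpq hqN hv hw hdet
      · rw [abs_of_nonpos h] at hpq hqN
        refine key M (-p) (-q) (-r) (-s) (by rwa [abs_neg]) hqN ?_ ?_ (by linear_combination hdet)
        · simpa using M.neg_mem hv
        · simpa using M.neg_mem hw
    intro M p q r s hp hq hv hw hdet
    rcases le_total |p| |q| with h | h
    · exact key' M p q r s h hq hv hw hdet
    · obtain ⟨p', q', r', s', hv', hw', hdet', hp', hq'⟩ :=
        key' (M.comap (AddEquiv.prodComm (M := ℤ) (N := ℤ)).toAddMonoidHom) q p (-s) (-r) h hp hv
          (M.neg_mem hw) (by linear_combination hdet)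
      exact ⟨q', p', -s', -r', hv', M.neg_mem hw', by linear_combination hdet', hq', hp'⟩

/-- On each of the lattice lines parallel to the first basis vector there is a lattice point in every
window of the length of that vector. -/
theorem exists_mem_line (M : AddSubgroup (ℤ × ℤ)) {n p q r s : ℤ} (hv : (p, q) ∈ M)
    (hw : (r, s) ∈ M) (hdet : p * s - q * r = n) (hq : 0 < q) (μ K B : ℤ)
    (hμ : 2 ∣ μ - p + q) (hK : 0 < K) :
    ∃ X Y : ℤ, (X, Y) ∈ M ∧ q * (2 * X - n) = p * (2 * Y - n) + n * μ ∧
      B ≤ K * (2 * Y - n) ∧ K * (2 * Y - n) < B + 2 * q * K := by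
  obtain ⟨m, hm⟩ := hμ
  have hL : 0 < 2 * q * K := by positivity
  -- The point `-m • (r, s)` lies on the required line; subtracting a multiple of `(p, q)` slides it
  -- into the window.
  set t := K * (2 * (-m * s) - n) - B with ht
  refine ⟨-m * r - t / (2 * q * K) * p, -m * s - t / (2 * q * K) * q, ?_, ?_, ?_, ?_⟩
  · have := M.sub_mem (M.zsmul_mem hw (-m)) (M.zsmul_mem hv (t / (2 * q * K)))
    simpa using this
  · linear_combination 2 * m * hdet - n * hm
  · have h1 := Int.emod_nonneg t hL.ne'
    have h3 := Int.mul_ediv_add_emod t (2 * q * K)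
    have h4 : K * (2 * (-m * s - t / (2 * q * K) * q) - n) = B + t % (2 * q * K) := by
      linear_combination -ht - h3
    linarith
  · have h1 := Int.emod_lt_of_pos t hL
    have h3 := Int.mul_ediv_add_emod t (2 * q * K)
    have h4 : K * (2 * (-m * s - t / (2 * q * K) * q) - n) = B + t % (2 * q * K) := by
      linear_combination -ht - h3
    linarith

theorem InGoodRegion.of_le {n X Y U W : ℤ} (hU : U = 2 * X - n) (hW : W = 2 * Y - n)
    (h1 : 3 * (U + W) ≤ 2 * n) (h2 : 3 * (U - W) ≤ 2 * n) (h3 : 3 * (-U + W) ≤ 2 * n)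
    (h4 : 3 * (-U - W) ≤ 2 * n) (h : n ≤ 3 * U ∨ n ≤ -3 * U ∨ n ≤ 3 * W ∨ n ≤ -3 * W) :
    InGoodRegion n X Y := by
  unfold InGoodRegion
  rw [← hU, ← hW]
  rcases abs_cases U with ⟨e1, _⟩ | ⟨e1, _⟩ <;> rcases abs_cases W with ⟨e2, _⟩ | ⟨e2, _⟩ <;>
    rw [e1, e2] <;> refine ⟨by linarith, ?_⟩ <;> omega

/-- In the coordinates `U = 2X - n`, `W = 2Y - n` the region is the diamond `|U| + |W| ≤ 2n/3`
without the open inscribed square `|U|, |W| < n/3`: four triangles. A row entering the upper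
triangle through its base `W = n/3`, far enough from both ends, stays inside for a height `2q`, and
so has a lattice point there. -/
theorem exists_inGoodRegion_of_nine_le (M : AddSubgroup (ℤ × ℤ)) {n p q r s : ℤ} (hv : (p, q) ∈ M)
    (hw : (r, s) ∈ M) (hdet : p * s - q * r = n) (hp : 0 ≤ p) (hpq : p ≤ q) (hqn : q ^ 2 ≤ n)
    (hq : 9 ≤ q) : ∃ X Y : ℤ, (X, Y) ∈ M ∧ InGoodRegion n X Y := by
  have hn : 81 ≤ n := by nlinarith
  -- Admissible entry points span `2n/3 - 4q` of the base, and consecutive rows are `2n/q` apart.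
  -- This inequality says that some row fits; it follows from `q ^ 2 ≤ n` and `9 ≤ q`.
  have hbig : 6 * n ≤ 2 * n * q - 12 * q ^ 2 := by nlinarith
  -- The row meets the base at `U = (p * n / 3 + n * μ) / q`. Starting at least `2 * (q - p)` to the
  -- right of the left corner keeps it off the left edge, since `W - U` grows by at most that much.
  obtain ⟨μ, hμ, h1, h2⟩ : ∃ μ : ℤ, 2 ∣ μ - p + q ∧
      -(n * q) + 6 * q * (q - p) ≤ p * n + 3 * n * μ ∧
      p * n + 3 * n * μ < -(n * q) + 6 * q * (q - p) + 6 * n := by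
    set t := p * n + 3 * n * (p - q) + n * q - 6 * q * (q - p) with ht
    have h6 : 0 < 6 * n := by linarith
    have e1 := Int.emod_nonneg t h6.ne'
    have e2 := Int.emod_lt_of_pos t h6
    have e3 := Int.mul_ediv_add_emod t (6 * n)
    refine ⟨p - q - 2 * (t / (6 * n)), ⟨-(t / (6 * n)), by ring⟩, ?_, ?_⟩ <;> linarith
  obtain ⟨X, Y, hM, hl, hb1, hb2⟩ :=
    exists_mem_line M hv hw hdet (by linarith) μ 3 n hμ (by norm_num)
  refine ⟨X, Y, hM, ?_⟩
  obtain ⟨U, hU⟩ : ∃ U, U = 2 * X - n := ⟨_, rfl⟩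
  obtain ⟨W, hW⟩ : ∃ W, W = 2 * Y - n := ⟨_, rfl⟩
  rw [← hU, ← hW] at hl
  rw [← hW] at hb1 hb2
  have hq0 : 0 < 3 * q := by linarith
  have a1 : p * (3 * W - n) ≤ p * (6 * q) := mul_le_mul_of_nonneg_left (by linarith) hp
  have a2 : 0 ≤ p * (3 * W - n) := mul_nonneg hp (by linarith)
  have a3 : (q - p) * (3 * W - n) ≤ (q - p) * (6 * q) :=
    mul_le_mul_of_nonneg_left (by linarith) (by linarith)
  have a4 : 0 ≤ (q - p) * (3 * W - n) := mul_nonneg (by linarith) (by linarith)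
  have a5 : q * (3 * W - n) ≤ q * (6 * q) := mul_le_mul_of_nonneg_left (by linarith) (by linarith)
  have a6 : 0 ≤ q * (3 * W - n) := mul_nonneg (by linarith) (by linarith)
  have a7 : 0 ≤ q * (q - p) := mul_nonneg (by linarith) (by linarith)
  have a8 : 0 ≤ q * p := mul_nonneg (by linarith) hp
  refine InGoodRegion.of_le hU hW ?_ ?_ ?_ ?_ (by omega) <;>
    refine le_of_mul_le_mul_left ?_ hq0 <;> nlinarith

theorem exists_inGoodRegion_of_row {M : AddSubgroup (ℤ × ℤ)} {n p q r s : ℤ} (hv : (p, q) ∈ M)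
    (hw : (r, s) ∈ M) (hdet : p * s - q * r = n) (hq : 0 < q) (μ K B : ℤ) (hμ : 2 ∣ μ - p + q)
    (hK : 0 < K)
    (h : ∀ U W Y : ℤ, q * U = p * W + n * μ → W = 2 * Y - n → B * n ≤ K * W →
      K * W < B * n + 2 * q * K →
      3 * (U + W) ≤ 2 * n ∧ 3 * (U - W) ≤ 2 * n ∧ 3 * (-U + W) ≤ 2 * n ∧ 3 * (-U - W) ≤ 2 * n ∧
        (n ≤ 3 * U ∨ n ≤ -3 * U ∨ n ≤ 3 * W ∨ n ≤ -3 * W)) :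
    ∃ X Y : ℤ, (X, Y) ∈ M ∧ InGoodRegion n X Y := by
  obtain ⟨X, Y, hM, hl, hb1, hb2⟩ := exists_mem_line M hv hw hdet hq μ K (B * n) hμ hK
  obtain ⟨h1, h2, h3, h4, h5⟩ := h _ _ Y hl rfl hb1 hb2
  exact ⟨X, Y, hM, .of_le rfl rfl h1 h2 h3 h4 h5⟩

set_option maxHeartbeats 2000000 in
-- The exceptions are genuine obstructions for rows: for `(0, 1)` all rows have `|U| ≥ n` and miss
-- the diamond, while for `(1, 1)` and `(2, 2)` the only row meeting it is the diagonal `U = W`,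
-- which lies in the inscribed square except possibly for touching its corners.
theorem exists_inGoodRegion_of_le_eight {M : AddSubgroup (ℤ × ℤ)} {n p q r s : ℤ} (hv : (p, q) ∈ M)
    (hw : (r, s) ∈ M) (hdet : p * s - q * r = n) (hp : 0 ≤ p) (hpq : p ≤ q) (hn : 66 ≤ n)
    (hq : q ≤ 8) : (∃ X Y : ℤ, (X, Y) ∈ M ∧ InGoodRegion n X Y) ∨
      p = 0 ∧ q = 1 ∨ p = 1 ∧ q = 1 ∨ p = 2 ∧ q = 2 := by
  have hq0 : 0 < q := by
    rcases (hp.trans hpq).eq_or_lt with h | h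
    · have : p = 0 := by omega
      subst this; rw [← h] at hdet; omega
    · exact h
  -- For every other direction a row `μ` and a window of height `2q` starting at `W = B * n / K` are
  -- given explicitly; with `66 ≤ n` the window fits in the region.
  interval_cases q <;> interval_cases p
  · simp
  · simp
  · exact .inl (exists_inGoodRegion_of_row hv hw hdet (by norm_num) 0 3 1
      (by norm_num) (by norm_num) (by omega))
  · exact .inl (exists_inGoodRegion_of_row hv hw hdet (by norm_num) (-1) 9 (-1)
      (by norm_num) (by norm_num) (by omega))
  · simp
  · exact .inl (exists_inGoodRegion_of_row hv hw hdet (by norm_num) (-1) 3 (-1)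
      (by norm_num) (by norm_num) (by omega))
  · exact .inl (exists_inGoodRegion_of_row hv hw hdet (by norm_num) 0 3 1
      (by norm_num) (by norm_num) (by omega))
  · exact .inl (exists_inGoodRegion_of_row hv hw hdet (by norm_num) (-1) 3 1
      (by norm_num) (by norm_num) (by omega))
  · exact .inl (exists_inGoodRegion_of_row hv hw hdet (by norm_num) (-2) 3 1
      (by norm_num) (by norm_num) (by omega))
  · exact .inl (exists_inGoodRegion_of_row hv hw hdet (by norm_num) (-2) 6 (-1)
      (by norm_num) (by norm_num) (by omega))
  · exact .inl (exists_inGoodRegion_of_row hv hw hdet (by norm_num) (-1) 3 1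
      (by norm_num) (by norm_num) (by omega))
  · exact .inl (exists_inGoodRegion_of_row hv hw hdet (by norm_num) (-2) 9 (-1)
      (by norm_num) (by norm_num) (by omega))
  · exact .inl (exists_inGoodRegion_of_row hv hw hdet (by norm_num) (-1) 3 1
      (by norm_num) (by norm_num) (by omega))
  · exact .inl (exists_inGoodRegion_of_row hv hw hdet (by norm_num) (-2) 3 1
      (by norm_num) (by norm_num) (by omega))
  · exact .inl (exists_inGoodRegion_of_row hv hw hdet (by norm_num) 1 3 1
      (by norm_num) (by norm_num) (by omega))
  · exact .inl (exists_inGoodRegion_of_row hv hw hdet (by norm_num) (-2) 9 (-2)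
      (by norm_num) (by norm_num) (by omega))
  · exact .inl (exists_inGoodRegion_of_row hv hw hdet (by norm_num) (-1) 3 1
      (by norm_num) (by norm_num) (by omega))
  · exact .inl (exists_inGoodRegion_of_row hv hw hdet (by norm_num) (-2) 3 1
      (by norm_num) (by norm_num) (by omega))
  · exact .inl (exists_inGoodRegion_of_row hv hw hdet (by norm_num) (-3) 27 (-1)
      (by norm_num) (by norm_num) (by omega))
  · exact .inl (exists_inGoodRegion_of_row hv hw hdet (by norm_num) (-2) 3 1
      (by norm_num) (by norm_num) (by omega))
  · exact .inl (exists_inGoodRegion_of_row hv hw hdet (by norm_num) (-2) 3 (-1)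
      (by norm_num) (by norm_num) (by omega))
  · exact .inl (exists_inGoodRegion_of_row hv hw hdet (by norm_num) (-3) 7 (-1)
      (by norm_num) (by norm_num) (by omega))
  · exact .inl (exists_inGoodRegion_of_row hv hw hdet (by norm_num) (-2) 4 (-1)
      (by norm_num) (by norm_num) (by omega))
  · exact .inl (exists_inGoodRegion_of_row hv hw hdet (by norm_num) (-3) 9 (-1)
      (by norm_num) (by norm_num) (by omega))
  · exact .inl (exists_inGoodRegion_of_row hv hw hdet (by norm_num) (-2) 3 1
      (by norm_num) (by norm_num) (by omega))
  · exact .inl (exists_inGoodRegion_of_row hv hw hdet (by norm_num) (-3) 3 1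
      (by norm_num) (by norm_num) (by omega))
  · exact .inl (exists_inGoodRegion_of_row hv hw hdet (by norm_num) (-4) 3 1
      (by norm_num) (by norm_num) (by omega))
  · exact .inl (exists_inGoodRegion_of_row hv hw hdet (by norm_num) (-3) 21 (-5)
      (by norm_num) (by norm_num) (by omega))
  · exact .inl (exists_inGoodRegion_of_row hv hw hdet (by norm_num) 0 3 1
      (by norm_num) (by norm_num) (by omega))
  · exact .inl (exists_inGoodRegion_of_row hv hw hdet (by norm_num) (-3) 27 (-5)
      (by norm_num) (by norm_num) (by omega))
  · exact .inl (exists_inGoodRegion_of_row hv hw hdet (by norm_num) (-2) 3 1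
      (by norm_num) (by norm_num) (by omega))
  · exact .inl (exists_inGoodRegion_of_row hv hw hdet (by norm_num) (-3) 33 (-5)
      (by norm_num) (by norm_num) (by omega))
  · exact .inl (exists_inGoodRegion_of_row hv hw hdet (by norm_num) (-4) 18 (-1)
      (by norm_num) (by norm_num) (by omega))
  · exact .inl (exists_inGoodRegion_of_row hv hw hdet (by norm_num) (-3) 3 1
      (by norm_num) (by norm_num) (by omega))
  · exact .inl (exists_inGoodRegion_of_row hv hw hdet (by norm_num) (-4) 3 1
      (by norm_num) (by norm_num) (by omega))
  · exact .inl (exists_inGoodRegion_of_row hv hw hdet (by norm_num) (-4) 6 (-1)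
      (by norm_num) (by norm_num) (by omega))
  · exact .inl (exists_inGoodRegion_of_row hv hw hdet (by norm_num) (-3) 27 (-7)
      (by norm_num) (by norm_num) (by omega))
  · exact .inl (exists_inGoodRegion_of_row hv hw hdet (by norm_num) (-4) 15 (-2)
      (by norm_num) (by norm_num) (by omega))
  · exact .inl (exists_inGoodRegion_of_row hv hw hdet (by norm_num) (-3) 33 (-7)
      (by norm_num) (by norm_num) (by omega))
  · exact .inl (exists_inGoodRegion_of_row hv hw hdet (by norm_num) (-4) 9 (-1)
      (by norm_num) (by norm_num) (by omega))
  · exact .inl (exists_inGoodRegion_of_row hv hw hdet (by norm_num) (-3) 3 1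
      (by norm_num) (by norm_num) (by omega))
  · exact .inl (exists_inGoodRegion_of_row hv hw hdet (by norm_num) (-4) 3 1
      (by norm_num) (by norm_num) (by omega))
  · exact .inl (exists_inGoodRegion_of_row hv hw hdet (by norm_num) (-5) 45 (-1)
      (by norm_num) (by norm_num) (by omega))
  · exact .inl (exists_inGoodRegion_of_row hv hw hdet (by norm_num) (-4) 3 1
      (by norm_num) (by norm_num) (by omega))

/-- If `|2X - n| ≥ n/3`, then `X` is within `n/3` of `0` on the circle, and so are `X + Y` and `Y`
of each other, in the same direction. The diamond inequality bounds the two remaining gaps, half of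
`|2X - n| ± (2Y - n)`, by `n/3`. -/
theorem exists_isPolychromatic_of_inGoodRegion {x y z k n X Y : ℤ} (hn : 0 < n)
    (hx : n ∣ k * x - X) (hy : n ∣ k * y - Y) (hz : n ∣ k * z - (X + Y))
    (h : InGoodRegion n X Y) :
    ∃ χ : ℤ → Fin 3, IsPolychromatic ({0, x, y, z} : Finset ℤ) χ := by
  have key : ∀ x y X Y : ℤ, n ∣ k * x - X → n ∣ k * y - Y → n ∣ k * z - (X + Y) →
      3 * (|2 * X - n| + |2 * Y - n|) ≤ 2 * n → n ≤ 3 * |2 * X - n| →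
      ∃ χ : ℤ → Fin 3, IsPolychromatic ({0, x, y, z} : Finset ℤ) χ := by
    rintro x y X Y ⟨i, hi⟩ ⟨j, hj⟩ ⟨l, hl⟩ h1 h2
    have hX1 := le_abs_self (2 * X - n)
    have hX2 := neg_le_abs (2 * X - n)
    have hY1 := le_abs_self (2 * Y - n)
    have hY2 := neg_le_abs (2 * Y - n)
    refine exists_isPolychromatic_of_circle (N := n) (k := k) (by simp) hn fun s hs => ?_
    simp only [Finset.mem_insert, Finset.mem_singleton] at hs
    rcases abs_cases (2 * X - n) with ⟨e, _⟩ | ⟨e, _⟩ <;> rw [e] at h1 h2 hX1 hX2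
    · rcases hs with rfl | rfl | rfl | rfl
      -- When two of the points coincide this gap is zero, and the positive step goes to the point
      -- after them.
      · by_cases h0 : X + Y - n = 0
        · exact ⟨y, by simp, Y, ⟨j, by linear_combination hj⟩, by omega, by omega⟩
        · exact ⟨z, by simp, X + Y - n, ⟨l + 1, by linear_combination hl⟩, by omega, by omega⟩
      · exact ⟨0, by simp, n - X, ⟨-i - 1, by linear_combination -hi⟩, by omega, by omega⟩
      · by_cases h0 : X - Y = 0
        · exact ⟨0, by simp, n - Y, ⟨-j - 1, by linear_combination -hj⟩, by omega, by omega⟩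
        · exact ⟨x, by simp, X - Y, ⟨i - j, by linear_combination hi - hj⟩, by omega, by omega⟩
      · exact ⟨y, by simp, n - X, ⟨j - l - 1, by linear_combination hj - hl⟩, by omega, by omega⟩
    · rcases hs with rfl | rfl | rfl | rfl
      · exact ⟨x, by simp, X, ⟨i, by linear_combination hi⟩, by omega, by omega⟩
      · by_cases h0 : Y - X = 0
        · exact ⟨z, by simp, Y, ⟨l - i, by linear_combination hl - hi⟩, by omega, by omega⟩
        · exact ⟨y, by simp, Y - X, ⟨j - i, by linear_combination hj - hi⟩, by omega, by omega⟩
      · exact ⟨z, by simp, X, ⟨l - j, by linear_combination hl - hj⟩, by omega, by omega⟩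
      · by_cases h0 : n - X - Y = 0
        · exact ⟨x, by simp, n - Y, ⟨i - l - 1, by linear_combination hi - hl⟩, by omega, by omega⟩
        · exact ⟨0, by simp, n - X - Y, ⟨-l - 1, by linear_combination -hl⟩, by omega, by omega⟩
  rcases h.2 with h2 | h2
  · exact key x y X Y hx hy hz h.1 h2
  · rw [Finset.insert_comm x y]
    exact key y x Y X hy hx (by rwa [add_comm Y]) (by rw [add_comm]; exact h.1) h2

/-- The region is symmetric under swapping the axes and under `X ↦ n - X`, which reduces any short
vector to `0 ≤ p ≤ q`. -/
theorem exists_inGoodRegion_of_basis (M : AddSubgroup (ℤ × ℤ)) {n p q r s : ℤ} (hn : 66 ≤ n)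
    (hM : (n, 0) ∈ M) (hv : (p, q) ∈ M) (hw : (r, s) ∈ M)
    (hdet : p * s - q * r = n) (hpn : p ^ 2 ≤ n) (hqn : q ^ 2 ≤ n) :
    (∃ X Y : ℤ, (X, Y) ∈ M ∧ InGoodRegion n X Y) ∨
      |p| = 0 ∧ |q| = 1 ∨ |p| = 1 ∧ |q| = 0 ∨ |p| = 1 ∧ |q| = 1 ∨ |p| = 2 ∧ |q| = 2 := by
  have key : ∀ (M : AddSubgroup (ℤ × ℤ)) {p q r s : ℤ}, (p, q) ∈ M → (r, s) ∈ M →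
      p * s - q * r = n → 0 ≤ p → 0 ≤ q → p ^ 2 ≤ n → q ^ 2 ≤ n →
      (∃ X Y : ℤ, (X, Y) ∈ M ∧ InGoodRegion n X Y) ∨
        p = 0 ∧ q = 1 ∨ p = 1 ∧ q = 0 ∨ p = 1 ∧ q = 1 ∨ p = 2 ∧ q = 2 := by
    intro M p q r s hv hw hdet hp hq hpn hqn
    rcases le_total p q with h | h
    · rcases le_or_gt q 8 with h8 | h8
      · rcases exists_inGoodRegion_of_le_eight hv hw hdet hp h hn h8 with h | h
        · exact .inl h
        · omega
      · exact .inl (exists_inGoodRegion_of_nine_le M hv hw hdet hp h hqn h8)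
    · let M' := M.comap (AddEquiv.prodComm (M := ℤ) (N := ℤ)).toAddMonoidHom
      have hv' : (q, p) ∈ M' := hv
      have hw' : (-s, -r) ∈ M' := M.neg_mem hw
      have hdet' : q * -r - p * -s = n := by linear_combination hdet
      rcases le_or_gt p 8 with h8 | h8
      · rcases exists_inGoodRegion_of_le_eight hv' hw' hdet' hq h hn h8 with ⟨X, Y, h, hR⟩ | h
        · exact .inl ⟨Y, X, h, hR.swap⟩
        · omega
      · obtain ⟨X, Y, h, hR⟩ := exists_inGoodRegion_of_nine_le M' hv' hw' hdet' hq h hpn h8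
        exact .inl ⟨Y, X, h, hR.swap⟩
  have key' : ∀ {p q r s : ℤ}, (p, q) ∈ M → (r, s) ∈ M →
      p * s - q * r = n → 0 ≤ q → p ^ 2 ≤ n → q ^ 2 ≤ n →
      (∃ X Y : ℤ, (X, Y) ∈ M ∧ InGoodRegion n X Y) ∨
        |p| = 0 ∧ q = 1 ∨ |p| = 1 ∧ q = 0 ∨ |p| = 1 ∧ q = 1 ∨ |p| = 2 ∧ q = 2 := by
    intro p q r s hv hw hdet hq hpn hqn
    rcases le_total 0 p with hp | hp
    · rw [abs_of_nonneg hp]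
      exact key M hv hw hdet hp hq hpn hqn
    · rw [abs_of_nonpos hp]
      let M' := M.comap ((-AddMonoidHom.id ℤ).prodMap (AddMonoidHom.id ℤ))
      have hv' : (-p, q) ∈ M' := by
        change (- -p, q) ∈ M
        rwa [neg_neg]
      have hw' : (r, -s) ∈ M' := M.neg_mem (x := (r, s)) hw
      rcases key M' hv' hw' (by linear_combination hdet) (by linarith) hq (by rwa [neg_sq]) hqn with
        ⟨X, Y, h, hR⟩ | h
      -- Undoing the mirror gives `(-X, Y)`; adding `(n, 0)`, which lies in `M`, gives the reflected
      -- point.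
      · refine .inl ⟨n - X, Y, ?_, hR.reflect⟩
        have h : (-X, Y) ∈ M := h
        simpa [sub_eq_add_neg] using M.add_mem hM h
      · exact .inr h
  rcases le_total 0 q with hq | hq
  · rw [abs_of_nonneg hq]
    exact key' hv hw hdet hq hpn hqn
  · rw [abs_of_nonpos hq, ← abs_neg p]
    exact key' (M.neg_mem hv) (M.neg_mem hw) (by linear_combination hdet) (by linarith)
      (by rwa [neg_sq]) (by rwa [neg_sq])

/-- The multiples of `(x, y)` in the torus `(ℤ / n)²`, as a lattice in the plane. -/
def multiplesLattice (x y n : ℤ) : AddSubgroup (ℤ × ℤ) where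
  carrier := {v | ∃ k : ℤ, n ∣ k * x - v.1 ∧ n ∣ k * y - v.2}
  zero_mem' := ⟨0, by simp, by simp⟩
  add_mem' := by
    rintro ⟨a, b⟩ ⟨c, d⟩ ⟨k, ⟨i, hi⟩, ⟨j, hj⟩⟩ ⟨l, ⟨i', hi'⟩, ⟨j', hj'⟩⟩
    simp only at hi hj hi' hj'
    exact ⟨k + l, ⟨i + i', show (k + l) * x - (a + c) = _ by linear_combination hi + hi'⟩,
      ⟨j + j', show (k + l) * y - (b + d) = _ by linear_combination hj + hj'⟩⟩
  neg_mem' := by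
    rintro ⟨a, b⟩ ⟨k, ⟨i, hi⟩, ⟨j, hj⟩⟩
    simp only at hi hj
    exact ⟨-k, ⟨-i, show -k * x - -a = _ by linear_combination -hi⟩,
      ⟨-j, show -k * y - -b = _ by linear_combination -hj⟩⟩

theorem exists_mul_inGoodRegion {x y n : ℤ} (hn : 66 ≤ n)
    (hg : ∀ g : ℤ, g ∣ x → g ∣ y → g ∣ n → IsUnit g) :
    (∃ k X Y : ℤ, n ∣ k * x - X ∧ n ∣ k * y - Y ∧ InGoodRegion n X Y) ∨
      n ∣ x ∨ n ∣ y ∨ n ∣ 2 * (x - y) ∨ n ∣ 2 * (x + y) := by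
  rcases Nat.eq_zero_or_pos (Int.gcd x y) with h0 | h0
  · exact .inr (.inl (by rw [(Int.gcd_eq_zero_iff.1 h0).1]; exact dvd_zero n))
  obtain ⟨x', y', hxy, hx, hy⟩ := Int.exists_gcd_one h0
  obtain ⟨g, hgdef⟩ : ∃ g : ℤ, g = Int.gcd x y := ⟨_, rfl⟩
  rw [← hgdef] at hx hy
  -- Since `g` is invertible mod `n`, the primitive vector `(x, y) / g` is itself a multiple of `(x,
  -- y)` mod `n`. Bézout coefficients of its coordinates, times `n`, supply a second lattice vector
  -- making the determinant exactly `n`.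
  have hgn : IsCoprime g n := by
    rw [← isRelPrime_iff_isCoprime]
    intro d hd hd'
    exact hg d (hd.trans (hx ▸ dvd_mul_left _ _)) (hd.trans (hy ▸ dvd_mul_left _ _)) hd'
  obtain ⟨i, j, hij⟩ := hgn
  obtain ⟨t, z, htz⟩ := Int.isCoprime_iff_gcd_eq_one.2 hxy
  let M := multiplesLattice x y n
  have hM : (n, 0) ∈ M := ⟨0, by simp, by simp⟩
  have hv : (x', y') ∈ M := ⟨i, ⟨-j * x', by rw [hx]; linear_combination x' * hij⟩,
    ⟨-j * y', by rw [hy]; linear_combination y' * hij⟩⟩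
  have hw : (-n * z, n * t) ∈ M := ⟨0, by simp, by simp⟩
  obtain ⟨p, q, r, s, hv, hw, hdet, hp, hq⟩ :=
    exists_short_basis (n := n) (by linarith) (max |x'| |y'|).toNat M x' y' (-n * z) (n * t)
      (by simp) (by simp) hv hw (by linear_combination n * htz)
  rcases exists_inGoodRegion_of_basis M hn hM hv hw hdet hp hq with
    ⟨X, Y, ⟨k, hk, hk'⟩, hR⟩ | h
  · exact .inl ⟨k, X, Y, hk, hk', hR⟩
  · right
    obtain ⟨k, ⟨a, ha⟩, ⟨b, hb⟩⟩ := hv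
    simp only at ha hb
    -- A multiple of `(x, y)` is parallel to it mod `n`, so each tiny vector `(p, q)` becomes a
    -- divisibility.
    have hdvd : n ∣ x * q - y * p := ⟨y * a - x * b, by linear_combination y * ha - x * hb⟩
    rcases h with ⟨h1, h2⟩ | ⟨h1, h2⟩ | ⟨h1, h2⟩ | ⟨h1, h2⟩
    · rw [abs_eq_zero] at h1
      rcases (abs_eq zero_le_one).1 h2 with h2 | h2 <;> rw [h1, h2] at hdvd
      · exact .inl (by simpa using hdvd)
      · exact .inl (by simpa using hdvd)
    · rw [abs_eq_zero] at h2
      rcases (abs_eq zero_le_one).1 h1 with h1 | h1 <;> rw [h1, h2] at hdvd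
      · exact .inr (.inl (by simpa using hdvd))
      · exact .inr (.inl (by simpa using hdvd))
    · obtain ⟨c, hc⟩ := hdvd
      rcases (abs_eq zero_le_one).1 h1 with h1 | h1 <;>
        rcases (abs_eq zero_le_one).1 h2 with h2 | h2 <;> rw [h1, h2] at hc
      · exact .inr (.inr (.inl ⟨2 * c, by linear_combination 2 * hc⟩))
      · exact .inr (.inr (.inr ⟨-2 * c, by linear_combination -2 * hc⟩))
      · exact .inr (.inr (.inr ⟨2 * c, by linear_combination 2 * hc⟩))
      · exact .inr (.inr (.inl ⟨-2 * c, by linear_combination -2 * hc⟩))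
    · obtain ⟨c, hc⟩ := hdvd
      rcases (abs_eq zero_le_two).1 h1 with h1 | h1 <;>
        rcases (abs_eq zero_le_two).1 h2 with h2 | h2 <;> rw [h1, h2] at hc
      · exact .inr (.inr (.inl ⟨c, by linear_combination hc⟩))
      · exact .inr (.inr (.inr ⟨-c, by linear_combination -hc⟩))
      · exact .inr (.inr (.inr ⟨c, by linear_combination hc⟩))
      · exact .inr (.inr (.inl ⟨-c, by linear_combination -hc⟩))

/-! ### The centroid case: a two-row colouring -/

/-- A coloring of `ℤ / 2h` with representatives `0 ≤ u < 2h` for which every translate of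
`{0, 1, h + 1, h + 2}` sees the colors `0, 1, 2`. -/
def twoRowColor (h u : ℤ) : ℤ :=
  if u < h then
    if u = 1 then 2 else if u = 0 ∨ u = 2 ∨ (u + h) % 2 = 1 then 0 else 1
  else if u = h ∨ h % 2 = 1 ∧ u = h + 2 ∨ h % 2 = 0 ∧ (u = h + 1 ∨ u = h + 3) then 1 else 2

theorem twoRowColor_left_zero {h u : ℤ} (hu : u < h ∧ u ≠ 1 ∧ (u = 0 ∨ u = 2 ∨ (u + h) % 2 = 1)) :
    twoRowColor h u = 0 := by
  rw [twoRowColor, if_pos hu.1, if_neg hu.2.1, if_pos hu.2.2]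

theorem twoRowColor_left_one {h u : ℤ} (hu : u < h ∧ u ≠ 1 ∧ ¬(u = 0 ∨ u = 2 ∨ (u + h) % 2 = 1)) :
    twoRowColor h u = 1 := by
  rw [twoRowColor, if_pos hu.1, if_neg hu.2.1, if_neg hu.2.2]

theorem twoRowColor_left_two {h u : ℤ} (hu : u < h ∧ u = 1) : twoRowColor h u = 2 := by
  rw [twoRowColor, if_pos hu.1, if_pos hu.2]

theorem twoRowColor_right_one {h u : ℤ} (hu : ¬u < h ∧
    (u = h ∨ h % 2 = 1 ∧ u = h + 2 ∨ h % 2 = 0 ∧ (u = h + 1 ∨ u = h + 3))) :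
    twoRowColor h u = 1 := by
  rw [twoRowColor, if_neg hu.1, if_pos hu.2]

theorem twoRowColor_right_two {h u : ℤ} (hu : ¬u < h ∧
    ¬(u = h ∨ h % 2 = 1 ∧ u = h + 2 ∨ h % 2 = 0 ∧ (u = h + 1 ∨ u = h + 3))) :
    twoRowColor h u = 2 := by
  rw [twoRowColor, if_neg hu.1, if_neg hu.2]

/-- Each translate has two neighbouring points in each half of `ℤ / 2h`, apart from the seams. Away
from the seams the lower half alternates `0, 1` and the upper half is constantly `2`, so all colours
occur; the exceptional values near the seams repair the rest, whence the split by position and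
parity. -/
theorem exists_twoRowColor_eq {h u p q r c : ℤ} (hh : 5 ≤ h) (hu : 0 ≤ u) (hu' : u < 2 * h)
    (hp : p = u + 1 ∨ p = u + 1 - 2 * h) (hp0 : 0 ≤ p) (hp1 : p < 2 * h)
    (hq : q = u + 1 + h ∨ q = u + 1 - h) (hq0 : 0 ≤ q) (hq1 : q < 2 * h)
    (hr : r = u + 2 + h ∨ r = u + 2 - h) (hr0 : 0 ≤ r) (hr1 : r < 2 * h)
    (hc : 0 ≤ c) (hc' : c < 3) :
    twoRowColor h u = c ∨ twoRowColor h p = c ∨ twoRowColor h q = c ∨ twoRowColor h r = c := by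
  have hcases : u = 0 ∨ u = 1 ∨ u = 2 ∨ (3 ≤ u ∧ u ≤ h - 2) ∨ u = h - 1 ∨ u = h ∨ u = h + 1 ∨
      u = h + 2 ∨ (u = h + 3 ∧ 6 ≤ h) ∨ (h + 4 ≤ u ∧ u ≤ 2 * h - 3) ∨ u = 2 * h - 2 ∨ u = 2 * h - 1 := by
    omega
  rcases Int.emod_two_eq_zero_or_one h with h2 | h2 <;>
  rcases Int.emod_two_eq_zero_or_one u with u2 | u2 <;>
  rcases hcases with hc | hc | hc | hc | hc | hc | hc | hc | hc | hc | hc | hc <;>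
  first
  | omega
  | rcases hp with hp | hp <;> rcases hq with hq | hq <;> rcases hr with hr | hr <;>
    first
    | omega
    | simp (disch := omega) only [twoRowColor_left_zero, twoRowColor_left_one,
        twoRowColor_left_two, twoRowColor_right_one, twoRowColor_right_two]
      omega

theorem exists_isPolychromatic_twoRow {h j x y z : ℤ} (hh : 5 ≤ h) (hx : 2 * h ∣ j * x - 1)
    (hy : 2 * h ∣ j * y - (1 + h)) (hz : 2 * h ∣ j * z - (2 + h)) :
    ∃ χ : ℤ → Fin 3, IsPolychromatic ({0, x, y, z} : Finset ℤ) χ := by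
  have hh2 : 0 < 2 * h := by linarith
  have hbd : ∀ u, 0 ≤ twoRowColor h u ∧ twoRowColor h u < 3 := by
    intro u
    unfold twoRowColor
    split_ifs <;> norm_num
  refine ⟨fun m => ⟨(twoRowColor h (j * m % (2 * h))).toNat, by
    have := hbd (j * m % (2 * h)); omega⟩, fun m c => ?_⟩
  have hmod : ∀ s t, 2 * h ∣ j * s - t → (j * (m + s) % (2 * h) = j * m % (2 * h) + t ∨
      j * (m + s) % (2 * h) = j * m % (2 * h) + t - 2 * h) ∨
        ¬ (0 ≤ j * m % (2 * h) + t ∧ j * m % (2 * h) + t < 2 * (2 * h)) := by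
    rintro s t ⟨i, hi⟩
    by_cases h0 : 0 ≤ j * m % (2 * h) + t ∧ j * m % (2 * h) + t < 2 * (2 * h)
    · left
      have e : j * (m + s) % (2 * h) = (j * m % (2 * h) + t) % (2 * h) := by
        rw [show j * (m + s) = j * m + t + 2 * h * i by linear_combination hi,
          Int.add_mul_emod_self_left, Int.emod_add_emod]
      rw [e]
      rcases lt_or_ge (j * m % (2 * h) + t) (2 * h) with h1 | h1
      · exact .inl (Int.emod_eq_of_lt h0.1 h1)
      · right
        rw [← Int.sub_emod_right, Int.emod_eq_of_lt (by linarith) (by linarith)]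
    · exact .inr h0
  have hnn : ∀ v, 0 ≤ v % (2 * h) ∧ v % (2 * h) < 2 * h := fun v =>
    ⟨Int.emod_nonneg _ hh2.ne', Int.emod_lt_of_pos _ hh2⟩
  have hu := hnn (j * m)
  have hp := hnn (j * (m + x))
  have hq := hnn (j * (m + y))
  have hr := hnn (j * (m + z))
  have hc := c.2
  have hp' := hmod x 1 hx
  have hq' := hmod y (1 + h) hy
  have hr' := hmod z (2 + h) hz
  have key := exists_twoRowColor_eq (c := (c : ℕ)) hh hu.1 hu.2 (p := j * (m + x) % (2 * h))
    (q := j * (m + y) % (2 * h)) (r := j * (m + z) % (2 * h)) (by omega) hp.1 hp.2 (by omega)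
    hq.1 hq.2 (by omega) hr.1 hr.2 (by omega) (by omega)
  rcases key with key | key | key | key
  · exact ⟨0, by simp, by ext; simp [key]⟩
  · exact ⟨x, by simp, by ext; simp [key]⟩
  · exact ⟨y, by simp, by ext; simp [key]⟩
  · exact ⟨z, by simp, by ext; simp [key]⟩

/-- Multiplying by the inverse `j` of `e` mod `2h` turns the set into `{0, 1, 1 + h, 2 + h}`: as `j`
is odd, `j * h ≡ h`. -/
theorem exists_isPolychromatic_of_isCoprime {h e y z : ℤ} (hh : 5 ≤ h) (ho : Odd e)
    (he : IsCoprime e h) (hy : 2 * h ∣ y - (e + h)) (hz : 2 * h ∣ z - (2 * e + h)) :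
    ∃ χ : ℤ → Fin 3, IsPolychromatic ({0, e, y, z} : Finset ℤ) χ := by
  have h2 : IsCoprime e 2 := by
    obtain ⟨k, hk⟩ := ho
    exact ⟨1, -k, by rw [hk]; ring⟩
  obtain ⟨j, i, hji⟩ := h2.mul_right he
  have hj : Odd j := by
    have : Odd (j * e) := ⟨-(i * h), by linear_combination hji⟩
    exact (Int.odd_mul.1 this).1
  obtain ⟨t, ht⟩ := hj
  obtain ⟨k, hk⟩ := hy
  obtain ⟨l, hl⟩ := hz
  exact exists_isPolychromatic_twoRow (j := j) hh ⟨-i, by linear_combination hji⟩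
    ⟨j * k - i + t, by linear_combination j * hk + hji + h * ht⟩
    ⟨j * l - 2 * i + t, by linear_combination j * hl + 2 * hji + h * ht⟩

/-- The case in which `b` is the centroid of the other three points. -/
theorem exists_isPolychromatic_of_centroid {a b c : ℤ} (hb : 3 * b = a + c) (hh : 5 ≤ 2 * b - a)
    (hg : IsCoprime a b) :
    ∃ χ : ℤ → Fin 3, IsPolychromatic ({0, a, b, c} : Finset ℤ) χ := by
  -- Here `c + b - a = 2h`, and mod `2h` the set is `{0, b, b + h, 2b + h}`. Whichever of `b`, `b +
  -- h` is odd serves as the unit `e`.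
  obtain ⟨h, rfl⟩ : ∃ h, a = 2 * b - h := ⟨2 * b - a, by ring⟩
  obtain rfl : c = b + h := by linarith
  rw [sub_sub_cancel] at hh
  obtain ⟨u, v, huv⟩ := hg
  have hbh : IsCoprime b h := ⟨2 * u + v, -u, by linear_combination huv⟩
  have hch : IsCoprime (b + h) h := ⟨2 * u + v, -3 * u - v, by linear_combination huv⟩
  rcases Int.even_or_odd b with hev | hodd
  · have ho : Odd (b + h) := by
      rcases Int.even_or_odd h with h1 | h1
      · have := hbh.isUnit_of_dvd' hev.two_dvd h1.two_dvd
        exact absurd this (by decide)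
      · exact hev.add_odd h1
    have := exists_isPolychromatic_of_isCoprime (y := b) (z := 2 * b - h) hh ho hch
      ⟨-1, by ring⟩ ⟨-2, by ring⟩
    convert this using 3
    ext m
    simp only [Finset.mem_insert, Finset.mem_singleton]
    tauto
  · have := exists_isPolychromatic_of_isCoprime (y := b + h) (z := 2 * b - h) hh hodd hbh
      ⟨0, by ring⟩ ⟨-1, by ring⟩
    convert this using 3
    ext m
    simp only [Finset.mem_insert, Finset.mem_singleton]
    tauto

/-! ### Three colours for any four integers -/

theorem exists_isPolychromatic_of_reflect {a b c : ℤ}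
    (h : ∃ χ : ℤ → Fin 3, IsPolychromatic ({0, c - b, c - a, c} : Finset ℤ) χ) :
    ∃ χ : ℤ → Fin 3, IsPolychromatic ({0, a, b, c} : Finset ℤ) χ := by
  obtain ⟨χ, hχ⟩ := h
  refine ⟨_, hχ.neg c fun t ht => ?_⟩
  simp only [Finset.mem_insert, Finset.mem_singleton] at ht ⊢
  omega

theorem exists_isPolychromatic_of_lt_of_lt {a b c : ℤ} (ha : 0 < a) (hab : a < b) (hbc : b < c)
    (hg : ∀ g : ℤ, g ∣ a → g ∣ b → g ∣ c → IsUnit g) :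
    ∃ χ : ℤ → Fin 3, IsPolychromatic ({0, a, b, c} : Finset ℤ) χ := by
  have hcen : ∀ {a b c : ℤ}, 0 < a → a < b → b < c →
      (∀ g : ℤ, g ∣ a → g ∣ b → g ∣ c → IsUnit g) → 3 * b = a + c →
      ∃ χ : ℤ → Fin 3, IsPolychromatic ({0, a, b, c} : Finset ℤ) χ := by
    intro a b c ha hab hbc hg h3
    by_cases h5 : 2 * b - a < 5
    -- The two cases too small for the two-row colouring already meet all residues mod 3.
    · have hab' : a = 1 ∧ b = 2 ∧ c = 5 ∨ a = 2 ∧ b = 3 ∧ c = 7 := by omega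
      rcases hab' with ⟨rfl, rfl, rfl⟩ | ⟨rfl, rfl, rfl⟩
      · exact exists_isPolychromatic_of_smallGaps (a := 1) (b := 2) (c := 5) (N := 3) (k := 1)
          (by norm_num) (by decide)
      · exact exists_isPolychromatic_of_smallGaps (a := 2) (b := 3) (c := 7) (N := 3) (k := 1)
          (by norm_num) (by decide)
    refine exists_isPolychromatic_of_centroid h3 (by omega) ?_
    rw [← isRelPrime_iff_isCoprime]
    intro g h1 h2
    refine hg g h1 h2 ?_
    rw [show c = 3 * b - a by linarith]
    exact (h2.mul_left 3).sub h1
  by_cases h3 : 3 * b = a + c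
  · exact hcen ha hab hbc hg h3
  have hg' : ∀ g : ℤ, g ∣ c - b → g ∣ c - a → g ∣ c → IsUnit g := by
    intro g h1 h2 h3
    exact hg g ((dvd_sub_right h3).1 h2) ((dvd_sub_right h3).1 h1) h3
  by_cases h3' : 3 * a = b + c
  · refine exists_isPolychromatic_of_reflect
      (hcen (by omega) (by omega) (by omega) hg' (by omega))
  by_cases hn : c + b - a < 66
  · have hsmall : ∀ {a b c : ℤ}, 0 < a → a < b → b < c → c + b - a < 66 → a + b ≤ c →
        (∀ g : ℤ, g ∣ a → g ∣ b → g ∣ c → IsUnit g) → 3 * b ≠ a + c → 3 * a ≠ b + c →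
        ∃ χ : ℤ → Fin 3, IsPolychromatic ({0, a, b, c} : Finset ℤ) χ := by
      intro a b c ha hab hbc hn habc hg h1 h2
      lift a to ℕ using ha.le
      lift b to ℕ using by omega
      lift c to ℕ using by omega
      refine exists_isPolychromatic_of_small (by omega) (by omega) (by omega) (by omega)
        (by omega) ?_ (by omega) (by omega)
      have := hg (Nat.gcd a (Nat.gcd b c) : ℕ)
        (Int.natCast_dvd_natCast.2 (Nat.gcd_dvd_left _ _))
        (Int.natCast_dvd_natCast.2 ((Nat.gcd_dvd_right _ _).trans (Nat.gcd_dvd_left _ _)))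
        (Int.natCast_dvd_natCast.2 ((Nat.gcd_dvd_right _ _).trans (Nat.gcd_dvd_right _ _)))
      simpa [Int.isUnit_iff] using this
    rcases le_total (a + b) c with h | h
    · exact hsmall ha hab hbc hn h hg h3 h3'
    · exact exists_isPolychromatic_of_reflect (hsmall (by omega) (by omega) (by omega) (by omega)
        (by omega) hg' (by omega) (by omega))
  have hdvd : ∀ {m : ℤ} (i : ℤ), c + b - a ∣ m → i * (c + b - a) < m →
      m < (i + 1) * (c + b - a) → False := by
    rintro m i ⟨k, rfl⟩ h1 h2
    have hpos : 0 < c + b - a := by omega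
    have h3 : i < k := by nlinarith
    have h4 : k < i + 1 := by nlinarith
    omega
  rcases exists_mul_inGoodRegion (x := b) (y := c) (n := c + b - a) (by omega) (fun g h1 h2 h3 =>
    hg g ((dvd_sub_right (h2.add h1)).1 h3) h1 h2) with ⟨k, X, Y, hX, hY, hR⟩ | h | h | h | h
  · have := exists_isPolychromatic_of_inGoodRegion (z := a) (by omega) hX hY
      (by
        obtain ⟨i, hi⟩ := hX
        obtain ⟨j, hj⟩ := hY
        exact ⟨i + j - k, by linear_combination hi + hj⟩) hR
    convert this using 3
    ext m
    simp only [Finset.mem_insert, Finset.mem_singleton]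
    tauto
  · exact (hdvd 0 h (by omega) (by omega)).elim
  · exact (hdvd 0 h (by omega) (by omega)).elim
  · exfalso
    -- `2 * (b - c)` lies strictly between `-2n` and `0`, so it would have to equal `-n`, which
    -- means `3 * b = a + c`. Below, `2 * a = n` likewise means `3 * a = b + c`.
    rcases lt_trichotomy (2 * (b - c)) (-1 * (c + b - a)) with h1 | h1 | h1
    · exact hdvd (-2) h (by omega) (by omega)
    · omega
    · exact hdvd (-1) h (by omega) (by omega)
  · exfalso
    have h' : c + b - a ∣ 2 * a := by
      have := (dvd_mul_left (c + b - a) 2).sub h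
      rw [show 2 * a = -(2 * (c + b - a) - 2 * (b + c)) by ring]
      exact this.neg_right
    rcases lt_trichotomy (2 * a) (1 * (c + b - a)) with h1 | h1 | h1
    · exact hdvd 0 h' (by omega) (by omega)
    · omega
    · exact hdvd 1 h' (by omega) (by omega)

/-- Every set of four integers has a polychromatic `3`-coloring. -/
theorem exists_isPolychromatic_int {S : Finset ℤ} (hS : S.card = 4) :
    ∃ χ : ℤ → Fin 3, IsPolychromatic S χ := by
  let o := S.orderEmbOfFin hS
  have h01 : o 0 < o 1 := o.strictMono (by decide)
  have h12 : o 1 < o 2 := o.strictMono (by decide)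
  have h23 : o 2 < o 3 := o.strictMono (by decide)
  have ho : ∀ i, o i ∈ S := S.orderEmbOfFin_mem hS
  obtain ⟨g, hgdef⟩ : ∃ g : ℤ, g = Int.gcd (o 1 - o 0) (Int.gcd (o 2 - o 0) (o 3 - o 0)) :=
    ⟨_, rfl⟩
  have hg1 : g ∣ o 1 - o 0 := hgdef ▸ Int.gcd_dvd_left _ _
  have hg2 : g ∣ o 2 - o 0 := hgdef ▸ (Int.gcd_dvd_right _ _).trans (Int.gcd_dvd_left _ _)
  have hg3 : g ∣ o 3 - o 0 := hgdef ▸ (Int.gcd_dvd_right _ _).trans (Int.gcd_dvd_right _ _)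
  have hg0 : 0 < g := by
    have : 0 ≤ g := by rw [hgdef]; positivity
    rcases this.eq_or_lt with h | h
    · rw [← h, zero_dvd_iff] at hg1; omega
    · exact h
  have hdvd : ∀ d, d ∣ o 1 - o 0 → d ∣ o 2 - o 0 → d ∣ o 3 - o 0 → d ∣ g := fun d h1 h2 h3 =>
    hgdef ▸ Int.dvd_coe_gcd h1 (Int.dvd_coe_gcd h2 h3)
  obtain ⟨a, ha⟩ := hg1
  obtain ⟨b, hb⟩ := hg2
  obtain ⟨c, hc⟩ := hg3
  obtain ⟨χ, hχ⟩ := exists_isPolychromatic_of_lt_of_lt (a := a) (b := b) (c := c) (by nlinarith)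
    (by nlinarith) (by nlinarith) (by
      intro d h1 h2 h3
      have h4 := hdvd (g * d) (ha ▸ mul_dvd_mul_left g h1) (hb ▸ mul_dvd_mul_left g h2)
        (hc ▸ mul_dvd_mul_left g h3)
      obtain ⟨e, he⟩ := h4
      exact IsUnit.of_mul_eq_one e
        (mul_left_cancel₀ hg0.ne' (by linear_combination -he)))
  refine ⟨_, hχ.of_map (AddMonoidHom.id ℤ) (D := g) (e := o 0) hg0.ne' fun t ht => ?_⟩
  simp only [Finset.mem_insert, Finset.mem_singleton] at ht
  rcases ht with rfl | rfl | rfl | rfl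
  · exact ⟨_, ho 0, by simp⟩
  · exact ⟨_, ho 1, by simp [← ha]⟩
  · exact ⟨_, ho 2, by simp [← hb]⟩
  · exact ⟨_, ho 3, by simp [← hc]⟩

/-! ### From `ℤ^d` to `ℤ` by linear functionals -/

theorem toRatPoint_injective {d : ℕ} : Function.Injective (toRatPoint (d := d)) := by
  intro v w h
  ext i
  simpa [toRatPoint] using congrFun h i

/-- A rational linear functional is proportional to an integral one. -/
theorem exists_integral_functional {d : ℕ} (f : Module.Dual ℚ (Fin d → ℚ)) :
    ∃ D : ℤ, D ≠ 0 ∧ ∃ φ : (Fin d → ℤ) →+ ℤ, ∀ x, (φ x : ℚ) = D * f (toRatPoint x) := by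
  obtain ⟨⟨D, hD⟩, hDi⟩ := IsLocalization.exist_integer_multiples (nonZeroDivisors ℤ) Finset.univ
    (fun i => f (fun j => if i = j then 1 else 0))
  refine ⟨D, nonZeroDivisors.ne_zero hD, ?_⟩
  choose n hn using fun i => hDi i (Finset.mem_univ i)
  refine ⟨AddMonoidHom.mk' (fun x => ∑ i, x i * n i) fun x y => by
    simp [add_mul, Finset.sum_add_distrib], fun x => ?_⟩
  rw [LinearMap.pi_apply_eq_sum_univ f (toRatPoint x), Finset.mul_sum]
  simp only [AddMonoidHom.mk'_apply, Int.cast_sum, Int.cast_mul]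
  refine Finset.sum_congr rfl fun i _ => ?_
  have := hn i
  simp only [algebraMap_int_eq, eq_intCast, zsmul_eq_mul] at this
  rw [this, smul_eq_mul, toRatPoint]
  ring

theorem exists_isPolychromatic_of_dual {d : ℕ} {S : Finset (Fin d → ℤ)} {T : Finset ℤ} {C : Type*}
    {χ : ℤ → C} (hχ : IsPolychromatic T χ) (f : Module.Dual ℚ (Fin d → ℚ)) (p : Fin d → ℤ)
    (h : ∀ t ∈ T, ∃ s ∈ S, f (toRatPoint s - toRatPoint p) = t) :
    ∃ χ : (Fin d → ℤ) → C, IsPolychromatic S χ := by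
  obtain ⟨D, hD, φ, hφ⟩ := exists_integral_functional f
  refine ⟨_, hχ.of_map φ (e := φ p) hD fun t ht => ?_⟩
  obtain ⟨s, hs, hst⟩ := h t ht
  refine ⟨s, hs, ?_⟩
  have : (φ s : ℚ) = D * t + φ p := by
    rw [hφ, hφ, ← hst, map_sub]; ring
  exact_mod_cast this

theorem exists_isPolychromatic_three {d : ℕ} {S : Finset (Fin d → ℤ)} (hS : S.card = 4) :
    ∃ χ : (Fin d → ℤ) → Fin 3, IsPolychromatic S χ := by
  -- Some functional is nonzero on all the finitely many differences of distinct points of `S`,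
  -- hence injective on `S`.
  obtain ⟨f, hf⟩ := Module.exists_dual_forall_apply_ne_zero (K := ℚ)
    (fun i : {i : S × S // i.1 ≠ i.2} => toRatPoint (i.1.1 : Fin d → ℤ) - toRatPoint i.1.2)
    (fun i => sub_ne_zero.2 fun h => i.2 (Subtype.ext (toRatPoint_injective h)))
  obtain ⟨D, hD, φ, hφ⟩ := exists_integral_functional f
  have hinj : Set.InjOn φ S := by
    intro s hs t ht hst
    by_contra hne
    refine hf ⟨(⟨s, hs⟩, ⟨t, ht⟩), fun h => hne (congrArg Subtype.val h)⟩ ?_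
    have h1 := hφ s
    rw [hst, hφ t] at h1
    rw [map_sub, sub_eq_zero]
    exact (mul_left_cancel₀ (by exact_mod_cast hD) h1).symm
  obtain ⟨χ, hχ⟩ := exists_isPolychromatic_int ((Finset.card_image_of_injOn hinj).trans hS)
  refine ⟨_, hχ.of_map φ (D := 1) (e := 0) one_ne_zero fun t ht => ?_⟩
  obtain ⟨s, hs, rfl⟩ := Finset.mem_image.1 ht
  exact ⟨s, hs, by ring⟩

/-! ### Four colours -/

theorem LinearIndependent.exists_dual_apply_eq {ι K V : Type*} [Field K] [AddCommGroup V]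
    [Module K V] {v : ι → V} (hv : LinearIndependent K v) (c : ι → K) :
    ∃ f : Module.Dual K V, ∀ i, f (v i) = c i := by
  obtain ⟨g, hg⟩ := LinearMap.exists_extend ((Module.Basis.span hv).constr K c)
  refine ⟨g, fun i => ?_⟩
  have := LinearMap.congr_fun hg (Module.Basis.span hv i)
  rw [Module.Basis.constr_basis] at this
  simpa [Module.Basis.span_apply] using this

theorem exists_isPolychromatic_four_of_affineIndependent {d : ℕ} {S : Finset (Fin d → ℤ)}
    (hS : S.card = 4) (h0 : 0 ∈ S)
    (h : AffineIndependent ℚ (fun t : S => toRatPoint (t : Fin d → ℤ))) :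
    ∃ χ : (Fin d → ℤ) → Fin 4, IsPolychromatic S χ := by
  let e : S ≃ Fin 4 := S.equivFinOfCardEq hS
  let o : S := ⟨0, h0⟩
  obtain ⟨f, hf⟩ := ((affineIndependent_iff_linearIndependent_vsub ℚ _ o).1 h).exists_dual_apply_eq
    (fun i => ((e i : ℕ) : ℚ) - (e o : ℕ))
  have hχ : IsPolychromatic (S.attach.image fun s => ((e s : ℕ) : ℤ) - (e o : ℕ))
      (fun m : ℤ => (⟨(m % 4).toNat, by omega⟩ : Fin 4)) := by
    intro n c
    have := c.2
    refine ⟨_, Finset.mem_image_of_mem _ (Finset.mem_attach S (e.symm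
      ⟨((c - n + (e o : ℕ)) % 4).toNat, by omega⟩)), ?_⟩
    ext
    simp only [Equiv.apply_symm_apply]
    omega
  refine exists_isPolychromatic_of_dual hχ f 0 fun t ht => ?_
  obtain ⟨s, -, rfl⟩ := Finset.mem_image.1 ht
  refine ⟨s, s.2, ?_⟩
  by_cases hs : s = o
  · subst hs; simp [o]
  · simpa [o] using hf ⟨s, hs⟩

/-- The colour records the binary digits of `n` at places `0` and `m`. The two pairs differ in
parity; within a pair, adding an odd multiple of `2 ^ m` flips digit `m` and, as `m ≠ 0`, keeps the
parity. -/
theorem isPolychromatic_two_pow {x y j : ℤ} {m : ℕ} (hm : m ≠ 0) (hj : Odd j) (hxy : Odd (y - x)) :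
    IsPolychromatic ({x, x + 2 ^ m * j, y, y + 2 ^ m} : Finset ℤ)
      (fun n => (⟨(2 * (n / 2 ^ m % 2) + n % 2).toNat, by omega⟩ : Fin 4)) := by
  intro n c
  have h2 : (2 : ℤ) ∣ 2 ^ m := dvd_pow_self 2 hm
  have hpos : (2 : ℤ) ^ m ≠ 0 := by positivity
  have e1 : (n + (x + 2 ^ m * j)) / 2 ^ m = (n + x) / 2 ^ m + j := by
    rw [← add_assoc, Int.add_mul_ediv_left _ _ hpos]
  have e2 : (n + (y + 2 ^ m)) / 2 ^ m = (n + y) / 2 ^ m + 1 := by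
    rw [← add_assoc, Int.add_ediv_of_dvd_right dvd_rfl, Int.ediv_self hpos]
  have e3 : (n + (x + 2 ^ m * j)) % 2 = (n + x) % 2 := by
    obtain ⟨k, hk⟩ := h2
    rw [hk, mul_assoc]; omega
  have e4 : (n + (y + 2 ^ m)) % 2 = (n + y) % 2 := by
    obtain ⟨k, hk⟩ := h2
    rw [hk]; omega
  have hc := c.2
  rw [Int.odd_iff] at hj hxy
  have key : (2 * ((n + x) / 2 ^ m % 2) + (n + x) % 2 = (c : ℕ) ∨
      2 * (((n + x) / 2 ^ m + j) % 2) + (n + x) % 2 = (c : ℕ)) ∨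
      2 * ((n + y) / 2 ^ m % 2) + (n + y) % 2 = (c : ℕ) ∨
      2 * (((n + y) / 2 ^ m + 1) % 2) + (n + y) % 2 = (c : ℕ) := by
    generalize (n + x) / 2 ^ m = u
    generalize (n + y) / 2 ^ m = v
    omega
  rcases key with (h | h) | h | h
  · exact ⟨x, by simp, by ext; simp [h]⟩
  · exact ⟨x + 2 ^ m * j, by simp, by ext; simp only [e1, e3, h, Int.toNat_natCast]⟩
  · exact ⟨y, by simp, by ext; simp [h]⟩
  · exact ⟨y + 2 ^ m, by simp, by ext; simp only [e2, e4, h, Int.toNat_natCast]⟩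

/-- By coprimality exactly one of `a`, `b`, `b - a` is even. Its two endpoints differ by `2 ^ m * j`
with `j` odd, and `c` is the remaining point plus `2 ^ m`. -/
theorem exists_isPolychromatic_four_int {a b : ℤ} (ha : a ≠ 0) (hb : b ≠ 0) (hab : a ≠ b)
    (hco : IsCoprime a b) :
    ∃ (c : ℤ) (χ : ℤ → Fin 4), IsPolychromatic ({0, a, b, c} : Finset ℤ) χ := by
  have hpow : ∀ z : ℤ, z ≠ 0 → Even z → ∃ (m : ℕ) (j : ℤ), m ≠ 0 ∧ Odd j ∧ z = 2 ^ m * j := by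
    intro z hz hev
    obtain ⟨j, hj, hj'⟩ := (Int.finiteMultiplicity_iff (a := 2) (b := z)).2
      ⟨by decide, hz⟩ |>.exists_eq_pow_mul_and_not_dvd
    refine ⟨_, j, ?_, ?_, hj⟩
    · intro h0
      rw [h0, pow_zero, one_mul] at hj
      exact hj' (hj ▸ hev.two_dvd)
    · rwa [← Int.not_even_iff_odd, even_iff_two_dvd]
  rcases Int.even_or_odd a with h1 | h1 <;> rcases Int.even_or_odd b with h2 | h2
  · exact absurd (hco.isUnit_of_dvd' h1.two_dvd h2.two_dvd) (by decide)
  · obtain ⟨m, j, hm, hj, rfl⟩ := hpow a ha h1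
    have := isPolychromatic_two_pow (x := 0) (y := b) hm hj (by simpa using h2)
    exact ⟨b + 2 ^ m, _, by simpa only [zero_add] using this⟩
  · obtain ⟨m, j, hm, hj, rfl⟩ := hpow b hb h2
    have := isPolychromatic_two_pow (x := 0) (y := a) hm hj (by simpa using h1)
    rw [zero_add, Finset.insert_comm (2 ^ m * j)] at this
    exact ⟨_, _, this⟩
  · obtain ⟨m, j, hm, hj, he⟩ := hpow (b - a) (sub_ne_zero.2 hab.symm) (h2.sub_odd h1)
    have := isPolychromatic_two_pow (x := a) (y := 0) hm hj (by simpa using h1)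
    rw [← he, add_sub_cancel, zero_add, Finset.insert_comm b, Finset.insert_comm a] at this
    exact ⟨_, _, this⟩

theorem exists_isPolychromatic_four_of_exactlyThreeCollinear {d : ℕ} {S : Finset (Fin d → ℤ)}
    (hS : S.card = 4) (h : ExactlyThreeCollinear S) :
    ∃ χ : (Fin d → ℤ) → Fin 4, IsPolychromatic S χ := by
  obtain ⟨⟨T, hTS, hT, hcol⟩, hnot⟩ := h
  have hncol : ¬ LatticeCollinear S := fun h => hnot ⟨S, subset_rfl, hS, h⟩
  obtain ⟨w, hw⟩ := Finset.card_eq_one.1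
    (show (S \ T).card = 1 by rw [Finset.card_sdiff_of_subset hTS, hS, hT])
  have hSw : S = insert w T := by
    rw [← Finset.union_sdiff_of_subset hTS, hw, Finset.union_comm]; rfl
  obtain ⟨t₀, t₁, t₂, h01, h02, h12, rfl⟩ := Finset.card_eq_three.1 hT
  unfold LatticeCollinear at hcol hncol
  rw [collinear_iff_of_mem (p₀ := toRatPoint t₀) (Set.mem_image_of_mem _ (by simp))] at hcol
  rw [collinear_iff_of_mem (p₀ := toRatPoint t₀) (Set.mem_image_of_mem _ (by simp [hSw]))] at hncol
  obtain ⟨v, hv⟩ := hcol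
  obtain ⟨r₁, hr₁⟩ := hv _ ⟨t₁, by simp, rfl⟩
  obtain ⟨r₂, hr₂⟩ := hv _ ⟨t₂, by simp, rfl⟩
  simp only [vadd_eq_add] at hr₁ hr₂ hncol
  have hr₁0 : r₁ ≠ 0 := by
    rintro rfl
    exact h01 (toRatPoint_injective (by simpa using hr₁.symm))
  have hr₂0 : r₂ ≠ 0 := by
    rintro rfl
    exact h02 (toRatPoint_injective (by simpa using hr₂.symm))
  have hr12 : r₁ ≠ r₂ := by
    rintro rfl
    exact h12 (toRatPoint_injective (hr₁.trans hr₂.symm))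
  have hv0 : v ≠ 0 := by
    rintro rfl
    exact h01 (toRatPoint_injective (by simpa using hr₁.symm))
  -- Writing the ratio in lowest terms and rescaling the direction to `v'` gives the collinear
  -- points the coprime coordinates `0`, `ρ.num`, `ρ.den`.
  set ρ := r₁ / r₂ with hρ
  have hden : (ρ.den : ℚ) ≠ 0 := by exact_mod_cast ρ.den_nz
  set v' := (r₂ / ρ.den) • v with hv'
  have hv'0 : v' ≠ 0 := smul_ne_zero (div_ne_zero hr₂0 hden) hv0
  have e₂ : toRatPoint t₂ - toRatPoint t₀ = (ρ.den : ℚ) • v' := by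
    rw [hr₂, hv', smul_smul, mul_div_cancel₀ _ hden, add_sub_cancel_right]
  have e₁ : toRatPoint t₁ - toRatPoint t₀ = (ρ.num : ℚ) • v' := by
    rw [hr₁, hv', smul_smul, add_sub_cancel_right]
    congr 1
    have : ρ * ρ.den = ρ.num := Rat.mul_den_eq_num ρ
    rw [← this, hρ]
    field_simp
  -- As `w` is off the line, a functional can be `1` on `v'` and take any prescribed value at `w`.
  have hli : LinearIndependent ℚ ![v', toRatPoint w - toRatPoint t₀] := by
    rw [LinearIndependent.pair_iff' hv'0]
    intro a haw
    refine hncol ⟨v, ?_⟩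
    rintro _ ⟨s, hs, rfl⟩
    rw [hSw] at hs
    simp only [Finset.coe_insert, Set.mem_insert_iff, Finset.coe_singleton,
      Set.mem_singleton_iff] at hs
    rcases hs with rfl | rfl | rfl | rfl
    · exact ⟨a * (r₂ / ρ.den), by rw [mul_smul, ← hv', haw, sub_add_cancel]⟩
    · exact ⟨0, by simp⟩
    · exact ⟨r₁, hr₁⟩
    · exact ⟨r₂, hr₂⟩
  obtain ⟨c, χ, hχ⟩ := exists_isPolychromatic_four_int (a := ρ.num) (b := ρ.den)
    (Rat.num_ne_zero.2 (div_ne_zero hr₁0 hr₂0)) (by exact_mod_cast ρ.den_nz)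
    (by
      intro h
      have h1 : ρ = 1 := by
        rw [← Rat.num_div_den ρ, h]
        simp
      exact hr12 ((div_eq_one_iff_eq hr₂0).1 h1))
    (Int.isCoprime_iff_gcd_eq_one.2 ρ.reduced)
  obtain ⟨f, hf⟩ := hli.exists_dual_apply_eq ![1, (c : ℚ)]
  have hf0 : f v' = 1 := hf 0
  have hf1 : f (toRatPoint w - toRatPoint t₀) = c := hf 1
  refine exists_isPolychromatic_of_dual hχ f t₀ fun t ht => ?_
  simp only [Finset.mem_insert, Finset.mem_singleton] at ht
  rcases ht with rfl | rfl | rfl | rfl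
  · exact ⟨t₀, by simp [hSw], by simp⟩
  · exact ⟨t₁, by simp [hSw], by rw [e₁, map_smul, hf0]; simp⟩
  · exact ⟨t₂, by simp [hSw], by rw [e₂, map_smul, hf0]; simp⟩
  · exact ⟨w, by simp [hSw], hf1⟩

theorem IsPolychromatic.le_card {G : Type*} [AddCommGroup G] {S : Finset G} {k : ℕ} {χ : G → Fin k}
    (hχ : IsPolychromatic S χ) : k ≤ S.card := by
  have h : (Finset.univ : Finset (Fin k)) ⊆ S.image (fun s => χ (0 + s)) := by
    intro c _
    obtain ⟨s, hs, h⟩ := hχ 0 c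
    exact Finset.mem_image.2 ⟨s, hs, h⟩
  simpa using (Finset.card_le_card h).trans Finset.card_image_le

theorem mainTheorem7 (d : ℕ) (hd : 2 ≤ d) (S : Finset (Fin d → ℤ)) (hcard : S.card = 4)
    (h0 : (0 : Fin d → ℤ) ∈ S) :
    (LatticeCollinear S → polychromaticNumber S = 3 ∨ polychromaticNumber S = 4) ∧
    (ExactlyThreeCollinear S → polychromaticNumber S = 4) ∧
    (3 ≤ d → InGeneralPosition S → polychromaticNumber S = 4) ∧
    (d = 2 → InGeneralPosition S → polychromaticNumber S = 3 ∨ polychromaticNumber S = 4) := by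
  obtain ⟨⟨χ, hχ⟩, hmax⟩ := isGreatest_polychromaticNumber S ⟨0, h0⟩
  have hle : polychromaticNumber S ≤ 4 := hcard ▸ hχ.le_card
  have hge : 3 ≤ polychromaticNumber S := hmax (exists_isPolychromatic_three hcard)
  refine ⟨fun _ => by omega, fun h => ?_, fun hd3 h => ?_, fun _ _ => by omega⟩
  · exact le_antisymm hle (hmax (exists_isPolychromatic_four_of_exactlyThreeCollinear hcard h))
  · exact le_antisymm hle (hmax (exists_isPolychromatic_four_of_affineIndependent hcard h0
      (h S subset_rfl (by omega))))
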